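/- Conventions. Structures are relational, with arbitrary (possibly infinite) signatures and nonempty domains; operations have arity $n\ge 1$. An at most countable structure $\mathbb A$ is *$\omega$-categorical* if for every $n\ge 1$ the componentwise action of $\mathrm{Aut}(\mathbb A)$ on $A^n$ has finitely many orbits. A *pp-formula* over $\mathbb A$ is a first-order formula built from relation symbols of $\mathbb A$ and equality using conjunction and existential quantification; a relation is *pp-definable* in $\mathbb A$ if it is defined by a pp-formula without parameters. A $k$-ary relation on $A^n$ is regarded as a $kn$-ary relation on $A$. * $\mathbb A$ *pp-interprets* $\mathbb B$ if for some $n\ge 1$ there is a map $f$ from a subset of $A^n$ onto $B$ such that the domain of $f$, and the $f$-preimages of equality on $B$ and of every relation of $\mathbb B$, are pp-definable in $\mathbb A$. * A *pp-power* of $\mathbb A$ is a structure isomorphic to one with domain $A^n$, $n\geq 1$, all of whose relations are pp-definable in $\mathbb A$. * Two structures of the same signature are *homomorphically equivalent* if there are homomorphisms between them in both directions. * A *model-complete core* is a structure $\mathbb C$ such that for every endomorphism $e$ and every finite $F\subseteq C$ some automorphism agrees with $e$ on $F$. * $\mathbb B$ is *pp-constructible* from $\mathbb A$ if there is a finite sequence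 $\mathbb A=\mathbb C_1,\dots,\mathbb C_k=\mathbb B$ such that for each $i<k$: $\mathbb C_i$ pp-interprets $\mathbb C_{i+1}$; or $\mathbb C_i$ and $\mathbb C_{i+1}$ are homomorphically equivalent; or $\mathbb C_i$ is an at most countable $\omega$-categorical model-complete core and $\mathbb C_{i+1}$ is obtained from it by adding one singleton unary relation. * $\mathrm{Pol}(\mathbb A)$ is the set of all finitary operations on $A$ preserving all relations of $\mathbb A$. For classes $K$ of sets of finitary operations (up to renaming elements of the domain): $\mathrm{P}_{\mathrm{fin}}K$ consists of the componentwise actions of members of $K$ on finite powers of their domains; $\mathrm{R}K$ consists of the *reflections* of members $F$ of $K$, i.e. the sets $\{(x_1,\dots,x_n)\mapsto h_2(f(h_1(x_1),\dots,h_1(x_n))) : f\in F\}$ of operations on a set $Y$, where $F$ is a set of operations on $X$ and $h_1:Y\to X$, $h_2:X\to Y$ are arbitrary maps; $\mathrm{E}K$ consists of the sets of operations obtained from members of $K$ by adding operations on the same domain. * An *h1 clone homomorphism* is an arity-preserving map $\xi:\mathrm{Pol}(\mathbb A)\to\mathrm{Pol}(\mathbb B)$ with $\xi(f(\pi^m_{i_1},\dots,\pi^m_{i_n}))=\xi(f)(\pi^m_{i_1},\dots,\pi^m_{i_n})$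 for all $m,n\ge1$, all $n$-ary $f\in\mathrm{Pol}(\mathbb A)$ and all $i_1,\dots,i_n\in\{1,\dots,m\}$, where $\pi^m_i$ denotes the $m$-ary projection to the $i$-th coordinate. It is *uniformly continuous* if for every finite $B'\subseteq B$ there is a finite $A'\subseteq A$ such that whenever $f,g\in\mathrm{Pol}(\mathbb A)$ of the same arity agree on $A'$ (on all tuples of elements of $A'$), $\xi(f)$ and $\xi(g)$ agree on $B'$. **Theorem 1.5.** Let $\mathbb A$ be an at most countable $\omega$-categorical structure and $\mathbb B$ a finite structure. Assume that all relations of $\mathbb B$ are nonempty, or that the empty unary relation is pp-definable in $\mathbb A$. Then the following are equivalent: 1. (i) $\mathbb B$ is homomorphically equivalent to a pp-power of $\mathbb A$; 2. (i') $\mathbb B$ is pp-constructible from $\mathbb A$; 3. (ii) $\mathrm{Pol}(\mathbb B)\in \mathrm{E}\,\mathrm{R}\,\mathrm{P}_{\mathrm{fin}}\{\mathrm{Pol}(\mathbb A)\}$; 4. (iii) there is a uniformly continuous h1 clone homomorphism $\mathrm{Pol}(\mathbb A)\to\mathrm{Pol}(\mathbb B)$. -/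

import Mathlib

open FirstOrder FirstOrder.Language.Structure

universe u v w

/-! ### Relational structures -/

/-- A relational structure: a signature without function symbols, a domain, and an interpretation
of every relation symbol. -/
structure RelStructure where
  L : FirstOrder.Language.{v, w}
  [isRelational : L.IsRelational]
  carrier : Type u
  [str : L.Structure carrier]

namespace RelStructure

attribute [instance] RelStructure.isRelational RelStructure.str

instance : CoeSort RelStructure.{u, v, w} (Type u) := ⟨RelStructure.carrier⟩

/-- `ω`-categoricity of an at most countable structure: for every `n ≥ 1` the componentwise action
of the automorphism group on `n`-tuples has only finitely many orbits, i.e. finitely many tuples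
represent all orbits. -/
def OmegaCategorical (A : RelStructure.{u, v, w}) : Prop :=
  ∀ n : ℕ, 1 ≤ n → ∃ S : Set (Fin n → A), S.Finite ∧
    ∀ x : Fin n → A, ∃ y ∈ S, ∃ g : A ≃[A.L] A, ∀ i, g (y i) = x i

/-- The automorphisms are dense in the endomorphisms. -/
def IsModelCompleteCore (A : RelStructure.{u, v, w}) : Prop :=
  ∀ (e : A →[A.L] A) (F : Set A), F.Finite → ∃ g : A ≃[A.L] A, ∀ a ∈ F, g a = e a

/-- Primitive positive formulas: built from equalities and predicates of the signature with
conjunction and existential quantification. -/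
inductive IsPP {L : FirstOrder.Language.{v, w}} {ι : Type} : ∀ {n : ℕ}, L.BoundedFormula ι n → Prop
  | equal {n : ℕ} (t₁ t₂ : L.Term (ι ⊕ Fin n)) : IsPP (t₁.bdEqual t₂)
  | rel {n k : ℕ} (R : L.Relations k) (ts : Fin k → L.Term (ι ⊕ Fin n)) :
      IsPP (R.boundedFormula ts)
  | inf {n : ℕ} {φ ψ : L.BoundedFormula ι n} : IsPP φ → IsPP ψ → IsPP (φ ⊓ ψ)
  | ex {n : ℕ} {φ : L.BoundedFormula ι (n + 1)} : IsPP φ → IsPP φ.ex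

/-- A relation on `A`, with coordinates indexed by `ι`, is pp-definable in `A` if it is defined by
a pp-formula without parameters. -/
def PPDefinable (A : RelStructure.{u, v, w}) {ι : Type} (S : Set (ι → A)) : Prop :=
  ∃ φ : A.L.Formula ι, IsPP φ ∧ S = {x | φ.Realize x}

/-- `A` pp-interprets `B`: there are `n ≥ 1` and a partial map `f` from `A ^ n` onto `B` such that
the domain of `f`, and the preimages of equality and of all the relations of `B`, are pp-definable
in `A`. A `k`-ary relation on `A ^ n` is regarded as a relation on `A` with coordinates indexed by
`Fin k × Fin n`. -/
def PPInterprets (A B : RelStructure.{u, v, w}) : Prop :=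
  ∃ n : ℕ, 1 ≤ n ∧ ∃ f : (Fin n → A) →. B,
    (∀ b : B, ∃ x, b ∈ f x) ∧
    A.PPDefinable f.Dom ∧
    A.PPDefinable {x : Fin 2 × Fin n → A |
      ∃ b : B, b ∈ f (fun j => x (0, j)) ∧ b ∈ f (fun j => x (1, j))} ∧
    ∀ (k : ℕ) (R : B.L.Relations k), A.PPDefinable {x : Fin k × Fin n → A |
      ∃ b : Fin k → B, (∀ i, b i ∈ f (fun j => x (i, j))) ∧ RelMap R b}

/-- `B` is a pp-power of `A`: it is isomorphic, via `e`, to a structure with domain `A ^ n`,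
`n ≥ 1`, all of whose relations are pp-definable in `A`. -/
def IsPPPower (B A : RelStructure.{u, v, w}) : Prop :=
  ∃ n : ℕ, 1 ≤ n ∧ ∃ e : (Fin n → A) ≃ B,
    ∀ (k : ℕ) (R : B.L.Relations k), A.PPDefinable {x : Fin k × Fin n → A |
      RelMap R (fun i => e (fun j => x (i, j)))}

/-- Homomorphic equivalence of relational structures; in particular, they have the same
signature. -/
inductive HomEquiv : RelStructure.{u, v, w} → RelStructure.{u, v, w} → Prop
  | mk (L : FirstOrder.Language.{v, w}) [L.IsRelational] (M N : Type u) [L.Structure M] [L.Structure N]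
      (f : M →[L] N) (g : N →[L] M) : HomEquiv ⟨L, M⟩ ⟨L, N⟩

/-- The only symbol of the signature `unaryLanguage`. -/
inductive UnarySymbol : ℕ → Type w
  | mk : UnarySymbol 1

/-- The signature with a single relation symbol, which is unary. -/
def unaryLanguage : FirstOrder.Language.{v, w} := ⟨fun _ => PEmpty, UnarySymbol⟩

instance : unaryLanguage.{v, w}.IsRelational := fun _ => inferInstanceAs (IsEmpty PEmpty)

/-- The interpretation of the unary symbol as the singleton `{s}`. -/
@[reducible]
def singletonStructure {M : Type u} (s : M) : unaryLanguage.{v, w}.Structure M where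
  funMap f := f.elim
  RelMap
    | .mk => fun x => x 0 = s

/-- The expansion of `A` by one further unary relation, which is the singleton `{s}`. -/
def addSingleton (A : RelStructure.{u, v, w}) (s : A) : RelStructure.{u, v, w} :=
  letI := singletonStructure.{u, v, w} s
  { L := A.L.sum unaryLanguage.{v, w}
    carrier := A }

/-- One step of a pp-construction. -/
inductive PPStep : RelStructure.{u, v, w} → RelStructure.{u, v, w} → Prop
  | interpretation {C D : RelStructure.{u, v, w}} : PPInterprets C D → PPStep C D
  | homEquiv {C D : RelStructure.{u, v, w}} : HomEquiv C D → PPStep C D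
  | singleton (C : RelStructure.{u, v, w}) (s : C) : Countable C → C.OmegaCategorical →
      C.IsModelCompleteCore → PPStep C (C.addSingleton s)

/-- `B` can be pp-constructed from `A` (by a finite, possibly empty, sequence of steps). -/
def PPConstructs (A B : RelStructure.{u, v, w}) : Prop :=
  Relation.ReflTransGen PPStep A B

end RelStructure

/-! ### Sets of functions and function clones -/

/-- A set of finitary operations, of arities `n ≥ 1`, on a domain. -/
structure FunctionSet where
  dom : Type u
  ops : ∀ n : ℕ+, Set ((Fin n → dom) → dom)

namespace FunctionSet

/-- `F` and `G` are equal up to renaming the elements of the domain. -/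
def IsRenaming (F G : FunctionSet.{u}) : Prop :=
  ∃ e : F.dom ≃ G.dom, ∀ n : ℕ+,
    G.ops n = {g | ∃ f ∈ F.ops n, g = fun x => e (f fun i => e.symm (x i))}

/-- The componentwise action of `F` on the `m`-th power of its domain. -/
def power (F : FunctionSet.{u}) (m : ℕ) : FunctionSet.{u} where
  dom := Fin m → F.dom
  ops n := {g | ∃ f ∈ F.ops n, g = fun x j => f fun i => x i j}

/-- The operator `P_fin`: componentwise actions on finite powers, up to renaming. -/
def finitePowers (K : Set FunctionSet.{u}) : Set FunctionSet.{u} :=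
  {G | ∃ F ∈ K, ∃ m : ℕ, IsRenaming (F.power m) G}

/-- The operator `R`: for maps `h₁ : B → A` and `h₂ : A → B`, the reflection of a set of
functions on `A` consists of the functions `h₂ (f (h₁ x₁, …, h₁ xₙ))`. -/
def reflections (K : Set FunctionSet.{u}) : Set FunctionSet.{u} :=
  {G | ∃ F ∈ K, ∃ (h₁ : G.dom → F.dom) (h₂ : F.dom → G.dom), ∀ n : ℕ+,
    G.ops n = {g | ∃ f ∈ F.ops n, g = fun x => h₂ (f fun i => h₁ (x i))}}

/-- The operator `E`: sets of functions obtained by adding functions, up to renaming. -/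
def expansions (K : Set FunctionSet.{u}) : Set FunctionSet.{u} :=
  {G | ∃ F ∈ K, ∃ e : F.dom ≃ G.dom, ∀ n : ℕ+, ∀ f ∈ F.ops n,
    (fun x => e (f fun i => e.symm (x i))) ∈ G.ops n}

end FunctionSet

/-- A function clone: a set of finitary operations that contains all projections and is closed
under composition. -/
structure FunctionClone extends FunctionSet.{u} where
  proj_mem : ∀ (n : ℕ+) (i : Fin n), (fun x => x i) ∈ ops n
  comp_mem : ∀ {n m : ℕ+} {f : (Fin n → dom) → dom} {g : Fin n → (Fin m → dom) → dom},
    f ∈ ops n → (∀ i, g i ∈ ops m) → (fun x => f fun i => g i x) ∈ ops m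

namespace FunctionClone

/-- The `n`-ary projection onto the `i`-th coordinate. -/
def proj (C : FunctionClone.{u}) (n : ℕ+) (i : Fin n) : C.ops n :=
  ⟨fun x => x i, C.proj_mem n i⟩

/-- The composition `f (g₁, …, gₙ)`. -/
def comp (C : FunctionClone.{u}) {n m : ℕ+} (f : C.ops n) (g : Fin n → C.ops m) : C.ops m :=
  ⟨fun x => f.1 fun i => (g i).1 x, C.comp_mem f.2 fun i => (g i).2⟩

/-- An arity preserving map between function clones. -/
abbrev ArityMap (C D : FunctionClone.{u}) := ∀ n : ℕ+, C.ops n → D.ops n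

/-- `ξ` is an h1 clone homomorphism (it preserves identities of height 1):
`ξ (f (π_{σ 1}, …, π_{σ n})) = ξ f (π_{σ 1}, …, π_{σ n})`. -/
def IsH1Hom {C D : FunctionClone.{u}} (ξ : ArityMap C D) : Prop :=
  ∀ (n m : ℕ+) (σ : Fin n → Fin m) (f : C.ops n),
    ξ m (C.comp f fun i => C.proj m (σ i)) = D.comp (ξ n f) fun i => D.proj m (σ i)

/-- Two functions of the same arity agree on the subset `S` of the domain. -/
def AgreeOn {X : Type u} {n : ℕ+} (f g : (Fin n → X) → X) (S : Set X) : Prop :=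
  ∀ x : Fin n → X, (∀ i, x i ∈ S) → f x = g x

/-- Uniform continuity with respect to the uniformity of pointwise convergence. -/
def IsUniformlyContinuous {C D : FunctionClone.{u}} (ξ : ArityMap C D) : Prop :=
  ∀ T : Set D.dom, T.Finite → ∃ S : Set C.dom, S.Finite ∧
    ∀ (n : ℕ+) (f g : C.ops n), AgreeOn f.1 g.1 S → AgreeOn (ξ n f).1 (ξ n g).1 T

end FunctionClone

/-- The polymorphism clone of `A`: all the finitary operations that preserve every relation. -/
def RelStructure.Pol (A : RelStructure.{u, v, w}) : FunctionClone.{u} where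
  dom := A
  ops n := {f | ∀ (k : ℕ) (R : A.L.Relations k) (t : Fin n → Fin k → A),
    (∀ i, RelMap R (t i)) → RelMap R fun j => f fun i => t i j}
  proj_mem _ i _ _ _ ht := ht i
  comp_mem hf hg k R t ht := hf k R _ fun i => hg i k R t ht

namespace RelStructure

/-! ### Closure properties of pp-definable relations -/

/-! Statement (i) amounts to concrete data: pp-definable relations `P` on a power of A, and maps
`h₁`, `h₂` between B and that power which carry each relation of B into its `P` and back. Such data
compose (`HomEquivPPPower.trans`) and every single step of a pp-construction provides them, the
delicate one being a new constant (`addSingleton_homEquivPPPower`); so (i') gives (i). Polymorphisms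
of A preserve each `P`, so sandwiching them between `h₁` and `h₂` gives polymorphisms of B, which is
(ii); the sandwich map is the ξ of (iii).

For (iii) to (i), uniform continuity makes `ξ f` depend only on `f` restricted to a finite set. With
n = |B|, the n-ary polymorphisms restricted to that set are points of a finite power of A, and
evaluating `ξ f` at an enumeration of B sends these points to B. A nonempty relation of B
corresponds to the relation that its image generates under Pol(A), which is pp-definable by
`OmegaCategorical.ppDefinable_of_invariant`. That lemma is a compactness argument: by
ω-categoricity, finitely many constraints decide which values on a finite set extend to
polymorphisms. -/

/-- The relations defined by nonempty conjunctions of atomic formulas. -/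
inductive IsConj (A : RelStructure.{u, v, w}) {V : Type} : Set (V → A) → Prop
  | eq (a b : V) : IsConj A {y | y a = y b}
  | rel {k : ℕ} (R : A.L.Relations k) (t : Fin k → V) : IsConj A {y | RelMap R fun i => y (t i)}
  | inter {S T : Set (V → A)} : IsConj A S → IsConj A T → IsConj A (S ∩ T)

theorem IsConj.preimage {A : RelStructure.{u, v, w}} {V W : Type} {S : Set (V → A)}
    (hS : A.IsConj S) (σ : V → W) : A.IsConj {y : W → A | (fun i => y (σ i)) ∈ S} := by
  induction hS with
  | eq a b => exact .eq (σ a) (σ b)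
  | rel R t => exact .rel R fun i => σ (t i)
  | inter _ _ h₁ h₂ => exact .inter h₁ h₂

theorem exists_var_eq {L : FirstOrder.Language.{v, w}} [L.IsRelational] {V : Type}
    (t : L.Term V) : ∃ a, t = .var a := by
  cases t with
  | var a => exact ⟨a, rfl⟩
  | func f _ => exact isEmptyElim f

theorem IsPP.exs {L : FirstOrder.Language.{v, w}} {ι : Type} :
    ∀ {n : ℕ} {φ : L.BoundedFormula ι n}, IsPP φ → IsPP φ.exs
  | 0, _, h => h
  | _ + 1, φ, h => IsPP.exs (φ := φ.ex) (.ex h)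

theorem IsConj.exists_isPP {A : RelStructure.{u, v, w}} {ι : Type} {N : ℕ}
    {T : Set (ι ⊕ Fin N → A)} (hT : A.IsConj T) :
    ∃ φ : A.L.BoundedFormula ι N, IsPP φ ∧ ∀ x y, φ.Realize x y ↔ Sum.elim x y ∈ T := by
  induction hT with
  | eq a b => exact ⟨_, .equal (.var a) (.var b), fun x y => by simp⟩
  | rel R t =>
    refine ⟨_, .rel R fun i => .var (t i), fun x y => ?_⟩
    simp [FirstOrder.Language.BoundedFormula.realize_rel]
  | inter _ _ h₁ h₂ =>
    obtain ⟨φ, hφ, h⟩ := h₁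
    obtain ⟨ψ, hψ, h'⟩ := h₂
    exact ⟨_, .inf hφ hψ, fun x y => by simp [h, h']⟩

/-- Prenex form: quantified variables are kept apart by disjoint unions and pulled to the front.
Later inductions then only meet conjunctions of atoms. -/
theorem IsPP.exists_isConj {A : RelStructure.{u, v, w}} {ι : Type} {n : ℕ}
    {φ : A.L.BoundedFormula ι n} (hφ : IsPP φ) :
    ∃ (W : Type) (_ : Finite W) (T : Set ((ι ⊕ Fin n) ⊕ W → A)), A.IsConj T ∧
      ∀ x z, φ.Realize x z ↔ ∃ y, Sum.elim (Sum.elim x z) y ∈ T := by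
  induction hφ with
  | equal t₁ t₂ =>
    obtain ⟨a, rfl⟩ := exists_var_eq t₁
    obtain ⟨b, rfl⟩ := exists_var_eq t₂
    exact ⟨Empty, inferInstance, _, .eq (.inl a) (.inl b), fun x z => by simp⟩
  | rel R ts =>
    choose a ha using fun i => exists_var_eq (ts i)
    obtain rfl : ts = fun i => .var (a i) := funext ha
    refine ⟨Empty, inferInstance, _, .rel R fun i => .inl (a i), fun x z => ?_⟩
    simp [FirstOrder.Language.BoundedFormula.realize_rel]
  | inf _ _ h₁ h₂ =>
    obtain ⟨W₁, _, T₁, hT₁, h₁⟩ := h₁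
    obtain ⟨W₂, _, T₂, hT₂, h₂⟩ := h₂
    refine ⟨W₁ ⊕ W₂, inferInstance, _,
      (hT₁.preimage (Sum.map id Sum.inl)).inter (hT₂.preimage (Sum.map id Sum.inr)), fun x z => ?_⟩
    rw [FirstOrder.Language.BoundedFormula.realize_inf, h₁, h₂]
    have key₁ (y : W₁ ⊕ W₂ → A) :
        (fun i => Sum.elim (Sum.elim x z) y (Sum.map id Sum.inl i)) =
          Sum.elim (Sum.elim x z) fun i => y (.inl i) := by
      ext (i | i) <;> rfl
    have key₂ (y : W₁ ⊕ W₂ → A) :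
        (fun i => Sum.elim (Sum.elim x z) y (Sum.map id Sum.inr i)) =
          Sum.elim (Sum.elim x z) fun i => y (.inr i) := by
      ext (i | i) <;> rfl
    simp only [Set.mem_inter_iff, Set.mem_ofPred_eq, key₁, key₂]
    constructor
    · rintro ⟨⟨y₁, hy₁⟩, y₂, hy₂⟩
      exact ⟨Sum.elim y₁ y₂, hy₁, hy₂⟩
    · rintro ⟨y, hy₁, hy₂⟩
      exact ⟨⟨_, hy₁⟩, _, hy₂⟩
  | @ex n _ _ h =>
    obtain ⟨W, _, T, hT, h⟩ := h
    refine ⟨Unit ⊕ W, inferInstance, _, hT.preimage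
      (Sum.elim (Sum.elim (fun i => .inl (.inl i))
        (Fin.lastCases (.inr (.inl ())) fun j => .inl (.inr j))) fun w => .inr (.inr w)),
      fun x z => ?_⟩
    rw [FirstOrder.Language.BoundedFormula.realize_ex]
    simp only [h, Set.mem_ofPred_eq]
    have key (y : Unit ⊕ W → A) : (fun i => Sum.elim (Sum.elim x z) y
        ((Sum.elim (Sum.elim (fun i => .inl (.inl i))
          (Fin.lastCases (.inr (.inl ())) fun j => .inl (.inr j))) fun w => .inr (.inr w) :
          (ι ⊕ Fin (n + 1)) ⊕ W → (ι ⊕ Fin n) ⊕ (Unit ⊕ W)) i)) =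
        Sum.elim (Sum.elim x (Fin.snoc z (y (.inl ())))) fun i => y (.inr i) := by
      ext ((i | i) | i)
      · rfl
      · induction i using Fin.lastCases <;> simp
      · rfl
    simp only [key]
    constructor
    · rintro ⟨a, y, hy⟩
      exact ⟨Sum.elim (fun _ => a) y, hy⟩
    · rintro ⟨y, hy⟩
      exact ⟨_, _, hy⟩

theorem IsConj.ppDefinable {A : RelStructure.{u, v, w}} {ι W : Type} [Finite W]
    {T : Set (ι ⊕ W → A)} (hT : A.IsConj T) : A.PPDefinable {x | ∃ y, Sum.elim x y ∈ T} := by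
  obtain ⟨N, ⟨e⟩⟩ := Finite.exists_equiv_fin W
  obtain ⟨φ, hφ, h⟩ := (hT.preimage (Sum.map id e)).exists_isPP
  refine ⟨φ.exs, hφ.exs, ?_⟩
  ext x
  simp only [Set.mem_ofPred_eq, FirstOrder.Language.BoundedFormula.realize_exs, h]
  have key (y : Fin N → A) : (fun i => Sum.elim x y (Sum.map id e i)) =
      Sum.elim x fun i => y (e i) := by
    ext (i | i) <;> rfl
  simp only [key]
  constructor
  · rintro ⟨y, hy⟩
    exact ⟨fun i => y (e.symm i), by simpa using hy⟩
  · rintro ⟨y, hy⟩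
    exact ⟨_, hy⟩

theorem PPDefinable.exists_isConj {A : RelStructure.{u, v, w}} {ι : Type} {S : Set (ι → A)}
    (hS : A.PPDefinable S) : ∃ (W : Type) (_ : Finite W) (T : Set (ι ⊕ W → A)), A.IsConj T ∧
      S = {x | ∃ y, Sum.elim x y ∈ T} := by
  obtain ⟨φ, hφ, rfl⟩ := hS
  obtain ⟨W, _, T, hT, h⟩ := hφ.exists_isConj
  refine ⟨W, inferInstance, _,
    hT.preimage (Sum.elim (Sum.elim Sum.inl Fin.elim0) Sum.inr), ?_⟩
  ext x
  simp only [Set.mem_ofPred_eq]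
  refine (h x _).trans (exists_congr fun y => iff_of_eq (congrArg (· ∈ T) ?_))
  ext ((i | i) | i)
  · rfl
  · exact i.elim0
  · rfl

theorem PPDefinable.exists {A : RelStructure.{u, v, w}} {ι W : Type} [Finite W]
    {T : Set (ι ⊕ W → A)} (hT : A.PPDefinable T) : A.PPDefinable {x | ∃ y, Sum.elim x y ∈ T} := by
  obtain ⟨W', _, T', hT', rfl⟩ := hT.exists_isConj
  convert (hT'.preimage (Equiv.sumAssoc ι W W')).ppDefinable using 1
  have key (x : ι → A) (y : W ⊕ W' → A) :
      (fun i => Sum.elim x y (Equiv.sumAssoc ι W W' i)) =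
      Sum.elim (Sum.elim x fun i => y (.inl i)) fun i => y (.inr i) := by
    ext ((i | i) | i) <;> rfl
  ext x
  simp only [Set.mem_ofPred_eq, key]
  constructor
  · rintro ⟨y, z, h⟩
    exact ⟨Sum.elim y z, h⟩
  · rintro ⟨y, h⟩
    exact ⟨_, _, h⟩

theorem PPDefinable.preimage {A : RelStructure.{u, v, w}} {ι κ : Type} {S : Set (ι → A)}
    (hS : A.PPDefinable S) (σ : ι → κ) : A.PPDefinable {y : κ → A | (fun i => y (σ i)) ∈ S} := by
  obtain ⟨W, _, T, hT, rfl⟩ := hS.exists_isConj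
  convert (hT.preimage (Sum.map σ id)).ppDefinable using 1
  ext x
  refine exists_congr fun y => iff_of_eq (congrArg (· ∈ T) ?_)
  ext (i | i) <;> rfl

theorem PPDefinable.inter {A : RelStructure.{u, v, w}} {ι : Type} {S T : Set (ι → A)} :
    A.PPDefinable S → A.PPDefinable T → A.PPDefinable (S ∩ T) := by
  rintro ⟨φ, hφ, rfl⟩ ⟨ψ, hψ, rfl⟩
  refine ⟨_, hφ.inf hψ, ?_⟩
  ext x
  exact FirstOrder.Language.Formula.realize_inf.symm

theorem IsConj.ppDefinable' {A : RelStructure.{u, v, w}} {ι : Type}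
    {T : Set (ι → A)} (hT : A.IsConj T) : A.PPDefinable T := by
  convert (hT.preimage (Sum.inl : ι → ι ⊕ Empty)).ppDefinable using 1
  ext x
  exact ⟨fun h => ⟨Empty.elim, h⟩, fun ⟨_, h⟩ => h⟩

theorem ppDefinable_eq (A : RelStructure.{u, v, w}) {ι : Type} (a b : ι) :
    A.PPDefinable {y : ι → A | y a = y b} := (IsConj.eq a b).ppDefinable'

theorem ppDefinable_rel (A : RelStructure.{u, v, w}) {ι : Type} {k : ℕ} (R : A.L.Relations k)
    (t : Fin k → ι) : A.PPDefinable {y : ι → A | RelMap R fun i => y (t i)} :=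
  (IsConj.rel R t).ppDefinable'

theorem ppDefinable_univ (A : RelStructure.{u, v, w}) [Nonempty A] (ι : Type) :
    A.PPDefinable (Set.univ : Set (ι → A)) := by
  -- There is no atom for truth, and `ι` may be empty, so the formula is `y = y` for a fresh
  -- quantified variable.
  convert (IsConj.eq (A := A) (V := ι ⊕ Unit) (.inr ()) (.inr ())).ppDefinable using 1
  ext x
  simp

theorem ppDefinable_forall (A : RelStructure.{u, v, w}) [Nonempty A] {ι : Type} {J : Type*} [Finite J]
    {S : J → Set (ι → A)} (hS : ∀ j, A.PPDefinable (S j)) : A.PPDefinable {x | ∀ j, x ∈ S j} := by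
  cases nonempty_fintype J
  suffices ∀ s : Finset J, A.PPDefinable {x | ∀ j ∈ s, x ∈ S j} by simpa using this Finset.univ
  intro s
  induction s using Finset.cons_induction with
  | empty => simpa using A.ppDefinable_univ ι
  | cons a s ha ih =>
    convert (hS a).inter ih using 1
    ext x
    simp

/-! ### Preservation of pp-definable relations -/

/-- Applying `f` also to the existential witnesses gives a witness for the image tuple. -/
theorem PPDefinable.pol_mem {A : RelStructure.{u, v, w}} {ι : Type} {S : Set (ι → A)}
    (hS : A.PPDefinable S) {n : ℕ+} {f : (Fin n → A) → A} (hf : f ∈ A.Pol.ops n)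
    {t : Fin n → ι → A} (ht : ∀ i, t i ∈ S) : (fun j => f fun i => t i j) ∈ S := by
  obtain ⟨W, _, T, hT, rfl⟩ := hS.exists_isConj
  choose y hy using ht
  refine ⟨fun j => f fun i => y i j, ?_⟩
  have key : Sum.elim (fun j => f fun i => t i j) (fun j => f fun i => y i j) =
      fun j => f fun i => Sum.elim (t i) (y i) j := by
    ext (j | j) <;> rfl
  rw [key]
  generalize (fun i => Sum.elim (t i) (y i)) = z at hy
  clear key hS
  induction hT with
  | eq a b => exact congrArg f (funext hy)
  | rel R s => exact hf _ R _ hy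
  | inter _ _ h₁ h₂ => exact ⟨h₁ fun i => (hy i).1, h₂ fun i => (hy i).2⟩

/-! ### Homomorphic equivalence with pp-powers -/

theorem HomEquiv.symm {A B : RelStructure.{u, v, w}} (h : A.HomEquiv B) : B.HomEquiv A := by
  cases h with
  | mk L M N f g => exact .mk L N M g f

/-- `B` is homomorphically equivalent to a pp-power of `A`. -/
def HomEquivPPPower (B A : RelStructure.{u, v, w}) : Prop :=
  ∃ C : RelStructure.{u, v, w}, C.IsPPPower A ∧ B.HomEquiv C

theorem HomEquivPPPower.exists_maps {A B : RelStructure.{u, v, w}} (h : B.HomEquivPPPower A) :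
    ∃ n : ℕ, 1 ≤ n ∧ ∃ (P : ∀ k, B.L.Relations k → Set (Fin k × Fin n → A))
      (h₁ : B → Fin n → A) (h₂ : (Fin n → A) → B),
      (∀ k R, A.PPDefinable (P k R)) ∧
      (∀ k (R : B.L.Relations k) t, RelMap R t → (fun p => h₁ (t p.1) p.2) ∈ P k R) ∧
      ∀ k (R : B.L.Relations k), ∀ x ∈ P k R, RelMap R fun i => h₂ fun j => x (i, j) := by
  obtain ⟨C, ⟨n, hn, e, he⟩, hBC⟩ := h
  cases hBC with
  | mk L M N f g =>
    refine ⟨n, hn, _, fun b => e.symm (f b), fun x => g (e x), he, fun k R t ht => ?_,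
      fun k R x hx => g.map_rel R _ hx⟩
    have := f.map_rel R _ ht
    simpa [Function.comp_def] using this

theorem HomEquivPPPower.of_maps {A B : RelStructure.{u, v, w}} {I : Type} [Finite I] [Nonempty I]
    (P : ∀ k, B.L.Relations k → Set (Fin k × I → A)) (h₁ : B → I → A) (h₂ : (I → A) → B)
    (hP : ∀ k R, A.PPDefinable (P k R))
    (hh₁ : ∀ k (R : B.L.Relations k) t, RelMap R t → (fun p => h₁ (t p.1) p.2) ∈ P k R)
    (hh₂ : ∀ k (R : B.L.Relations k), ∀ x ∈ P k R, RelMap R fun i => h₂ fun j => x (i, j)) :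
    B.HomEquivPPPower A := by
  obtain ⟨n, ⟨e⟩⟩ := Finite.exists_equiv_fin I
  have hn : 1 ≤ n := by
    have : 0 < Nat.card I := Nat.card_pos
    rw [Nat.card_congr e, Nat.card_fin] at this
    exact this
  let S : B.L.Structure (Fin n → A) :=
    { funMap := fun f => isEmptyElim f
      RelMap := fun {k} R x => (fun p : Fin k × I => x p.1 (e p.2)) ∈ P k R }
  refine ⟨⟨B.L, Fin n → A⟩, ⟨n, hn, Equiv.refl _, fun k R => ?_⟩, ?_⟩
  · exact (hP k R).preimage fun p : Fin k × I => (p.1, e p.2)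
  · refine .mk B.L B (Fin n → A) ⟨fun b j => h₁ b (e.symm j), fun f => isEmptyElim f, ?_⟩
      ⟨fun x => h₂ fun i => x (e i), fun f => isEmptyElim f, ?_⟩
    · intro k R t ht
      change (fun p : Fin k × I => h₁ (t p.1) (e.symm (e p.2))) ∈ P k R
      simpa using hh₁ k R t ht
    · intro k R x hx
      exact hh₂ k R _ hx

theorem HomEquivPPPower.of_homEquiv {A B : RelStructure.{u, v, w}} (h : A.HomEquiv B) :
    B.HomEquivPPPower A := by
  refine ⟨A, ⟨1, le_rfl, Equiv.funUnique (Fin 1) A, fun k R => ?_⟩, h.symm⟩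
  exact A.ppDefinable_rel R fun i => (i, 0)

theorem HomEquivPPPower.refl (A : RelStructure.{u, v, w}) : A.HomEquivPPPower A :=
  .of_homEquiv <| .mk A.L A A (.id A.L A) (.id A.L A)

/-- Pp-definitions over `B` can be transferred along maps between `B` and a power of `A` that
respect pp-definable interpretations of the relations of `B`. -/
theorem PPDefinable.transfer {A B : RelStructure.{u, v, w}} [Nonempty A] {I : Type} [Finite I]
    {P : ∀ k, B.L.Relations k → Set (Fin k × I → A)} {h₁ : B → I → A} {h₂ : (I → A) → B}
    (hP : ∀ k R, A.PPDefinable (P k R))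
    (hh₁ : ∀ k (R : B.L.Relations k) t, RelMap R t → (fun p => h₁ (t p.1) p.2) ∈ P k R)
    (hh₂ : ∀ k (R : B.L.Relations k), ∀ x ∈ P k R, RelMap R fun i => h₂ fun j => x (i, j))
    {ι : Type} {S : Set (ι → B)} (hS : B.PPDefinable S) :
    ∃ S' : Set (ι × I → A), A.PPDefinable S' ∧ (∀ x ∈ S, (fun p => h₁ (x p.1) p.2) ∈ S') ∧
      ∀ x ∈ S', (fun i => h₂ fun j => x (i, j)) ∈ S := by
  obtain ⟨W, _, T, hT, rfl⟩ := hS.exists_isConj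
  have key : ∃ T' : Set ((ι ⊕ W) × I → A), A.PPDefinable T' ∧
      (∀ x ∈ T, (fun p => h₁ (x p.1) p.2) ∈ T') ∧
      ∀ x ∈ T', (fun i => h₂ fun j => x (i, j)) ∈ T := by
    clear hS
    induction hT with
    | eq a b =>
      refine ⟨{x | ∀ j, x (a, j) = x (b, j)}, A.ppDefinable_forall fun j => A.ppDefinable_eq _ _,
        fun x hx j => ?_, fun x hx => ?_⟩
      · exact congrFun (congrArg h₁ hx) j
      · exact congrArg h₂ (funext hx)
    | rel R t =>
      exact ⟨_, (hP _ R).preimage fun p => (t p.1, p.2), fun x hx => hh₁ _ R _ hx,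
        fun x hx => hh₂ _ R _ hx⟩
    | inter _ _ ih₁ ih₂ =>
      obtain ⟨T₁, hT₁, h₁, h₁'⟩ := ih₁
      obtain ⟨T₂, hT₂, h₂, h₂'⟩ := ih₂
      exact ⟨_, hT₁.inter hT₂, fun x hx => ⟨h₁ x hx.1, h₂ x hx.2⟩,
        fun x hx => ⟨h₁' x hx.1, h₂' x hx.2⟩⟩
  obtain ⟨T', hT', h, h'⟩ := key
  refine ⟨_, (hT'.preimage (Equiv.sumProdDistrib ι W I)).exists, ?_, ?_⟩
  · rintro x ⟨y, hy⟩
    refine ⟨fun p => h₁ (y p.1) p.2, ?_⟩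
    rw [Set.mem_ofPred_eq]
    convert h _ hy using 1
    ext ⟨i | i, j⟩ <;> rfl
  · rintro x ⟨y, hy⟩
    refine ⟨fun i => h₂ fun j => y (i, j), ?_⟩
    convert h' _ hy using 1
    ext (i | i) <;> rfl

theorem HomEquivPPPower.trans {A B C : RelStructure.{u, v, w}} [Nonempty A]
    (hCB : C.HomEquivPPPower B) (hBA : B.HomEquivPPPower A) : C.HomEquivPPPower A := by
  obtain ⟨n, hn, P, h₁, h₂, hP, hh₁, hh₂⟩ := hBA.exists_maps
  obtain ⟨m, hm, Q, g₁, g₂, hQ, hg₁, hg₂⟩ := hCB.exists_maps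
  choose S hS hS₁ hS₂ using fun k R => (hQ k R).transfer hP hh₁ hh₂
  have : NeZero n := ⟨by omega⟩
  have : NeZero m := ⟨by omega⟩
  refine .of_maps (I := Fin m × Fin n) (fun k R => {x | (fun p => x (p.1.1, p.1.2, p.2)) ∈ S k R})
    (fun c p => h₁ (g₁ c p.1) p.2) (fun x => g₂ fun i => h₂ fun j => x (i, j))
    (fun k R => (hS k R).preimage _) (fun k R t ht => ?_) (fun k R x hx => ?_)
  · exact hS₁ k R _ (hg₁ k R t ht)
  · exact hg₂ k R _ (hS₂ k R _ hx)

open Classical in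
-- Choose preimages for `h₁` and any total extension of the interpreting map for `h₂`: tuples in the
-- preimage of a relation lie in the domain, so the default value never matters.
theorem PPInterprets.homEquivPPPower {A B : RelStructure.{u, v, w}} [Nonempty B]
    (h : A.PPInterprets B) : B.HomEquivPPPower A := by
  obtain ⟨n, hn, f, hf, -, -, hR⟩ := h
  have : NeZero n := ⟨by omega⟩
  choose g hg using hf
  have hF (x : Fin n → A) (b : B) (hb : b ∈ f x) :
      (if h : (f x).Dom then (f x).get h else Classical.arbitrary B) = b := by
    obtain ⟨h, rfl⟩ := hb
    exact dif_pos h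
  refine .of_maps _ g (fun x => if h : (f x).Dom then (f x).get h else Classical.arbitrary B)
    hR (fun k R t ht => ⟨t, fun i => hg (t i), ht⟩) ?_
  rintro k R x ⟨b, hb, hRb⟩
  rwa [show (fun i => _) = b from funext fun i => hF _ _ (hb i)]

theorem IsPPPower.ppInterprets {A C : RelStructure.{u, v, w}} [Nonempty A] (h : C.IsPPPower A) :
    A.PPInterprets C := by
  obtain ⟨n, hn, e, he⟩ := h
  refine ⟨n, hn, fun x => Part.some (e x), fun b => ⟨e.symm b, by simp⟩, ?_, ?_, fun k R => ?_⟩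
  · convert A.ppDefinable_univ (Fin n) using 1
    ext x
    simp
  · convert A.ppDefinable_forall fun j : Fin n => A.ppDefinable_eq ((0 : Fin 2), j) (1, j) using 1
    ext x
    simp [funext_iff]
  · convert he k R using 1
    ext x
    simp only [Part.mem_some_iff, Set.mem_ofPred_eq]
    constructor
    · rintro ⟨b, hb, h⟩
      rwa [← show b = _ from funext hb]
    · intro h
      exact ⟨_, fun i => rfl, h⟩

theorem HomEquivPPPower.ppConstructs {A B : RelStructure.{u, v, w}} [Nonempty A]
    (h : B.HomEquivPPPower A) : A.PPConstructs B := by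
  obtain ⟨C, hC, hBC⟩ := h
  exact (Relation.ReflTransGen.single (.interpretation hC.ppInterprets)).tail (.homEquiv hBC.symm)

theorem HomEquivPPPower.nonempty {A B : RelStructure.{u, v, w}} [Nonempty B]
    (h : B.HomEquivPPPower A) : Nonempty A := by
  obtain ⟨n, hn, -, h₁, -⟩ := h.exists_maps
  exact ⟨h₁ (Classical.arbitrary B) ⟨0, hn⟩⟩

/-! ### Invariant relations of `ω`-categorical structures -/

theorem OmegaCategorical.exists_orbit_representatives {A : RelStructure.{u, v, w}}
    (hA : A.OmegaCategorical) (ι : Type*) [Finite ι] : ∃ S : Set (ι → A), S.Finite ∧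
      ∀ x : ι → A, ∃ y ∈ S, ∃ g : A ≃[A.L] A, ∀ i, g (y i) = x i := by
  obtain ⟨n, ⟨e⟩⟩ := Finite.exists_equiv_fin ι
  rcases Nat.eq_zero_or_pos n with rfl | hn
  · have : IsEmpty ι := e.isEmpty
    exact ⟨Set.univ, Set.toFinite _, fun x => ⟨x, trivial, .refl A.L A, fun i => rfl⟩⟩
  · obtain ⟨S, hS, h⟩ := hA n hn
    refine ⟨(fun y i => y (e i)) '' S, hS.image _, fun x => ?_⟩
    obtain ⟨y, hy, g, hg⟩ := h fun i => x (e.symm i)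
    exact ⟨_, ⟨y, hy, rfl⟩, g, fun i => by simp [hg]⟩

/-- The maps `P → A` that satisfy a set of atomic constraints, each of which requires that a tuple
of elements of `P` is mapped into a relation of `A`. -/
def solutions (A : RelStructure.{u, v, w}) {P : Type*}
    (F : Set (Σ k, A.L.Relations k × (Fin k → P))) : Set (P → A) :=
  {h | ∀ c ∈ F, RelMap c.2.1 fun i => h (c.2.2 i)}

/-- Every finite subset of the constraints `Φ` has a solution that agrees with `h` on `Q`. -/
def IsFinitelySolvable (A : RelStructure.{u, v, w}) {P : Type*}
    (Φ : Set (Σ k, A.L.Relations k × (Fin k → P))) (Q : Set P) (h : P → A) : Prop :=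
  ∀ G ⊆ Φ, G.Finite → ∃ h' ∈ A.solutions G, Set.EqOn h' h Q

section

variable {A : RelStructure.{u, v, w}} {P : Type*} {Φ : Set (Σ k, A.L.Relations k × (Fin k → P))}

theorem solutions_anti {F G : Set (Σ k, A.L.Relations k × (Fin k → P))} (h : F ⊆ G) :
    A.solutions G ⊆ A.solutions F :=
  fun _ hf c hc => hf c (h hc)

theorem automorphism_comp_mem_solutions {F : Set (Σ k, A.L.Relations k × (Fin k → P))}
    {h : P → A} (hh : h ∈ A.solutions F) (g : A ≃[A.L] A) : (fun p => g (h p)) ∈ A.solutions F :=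
  fun c hc => (g.map_rel c.2.1 _).2 (hh c hc)

/-- Up to automorphisms, which preserve solutions, there are finitely many assignments on `Q`. For
each representative that fails some finite set of constraints, put one such set into `F`. -/
theorem OmegaCategorical.exists_finite_subset_isFinitelySolvable (hA : A.OmegaCategorical)
    (Φ : Set (Σ k, A.L.Relations k × (Fin k → P))) {Q : Set P} (hQ : Q.Finite) :
    ∃ F ⊆ Φ, F.Finite ∧ ∀ h ∈ A.solutions F, A.IsFinitelySolvable Φ Q h := by
  have := hQ.to_subtype
  obtain ⟨Y, hY, hYA⟩ := hA.exists_orbit_representatives Q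
  have key (y : Q → A) : ∃ F ⊆ Φ, F.Finite ∧ ((∃ h ∈ A.solutions F, ∀ q : Q, h q = y q) →
      ∀ G ⊆ Φ, G.Finite → ∃ h ∈ A.solutions G, ∀ q : Q, h q = y q) := by
    by_cases hy : ∀ G ⊆ Φ, G.Finite → ∃ h ∈ A.solutions G, ∀ q : Q, h q = y q
    · exact ⟨∅, Set.empty_subset _, Set.finite_empty, fun _ => hy⟩
    · push Not at hy
      obtain ⟨G, hG, hGf, h⟩ := hy
      refine ⟨G, hG, hGf, ?_⟩
      rintro ⟨f, hf, hfy⟩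
      obtain ⟨q, hq⟩ := h f hf
      exact absurd (hfy q) hq
  choose F hFΦ hF hFy using key
  refine ⟨⋃ y ∈ Y, F y, Set.iUnion₂_subset fun y _ => hFΦ y, hY.biUnion fun y _ => hF y,
    fun h hh G hG hGf => ?_⟩
  obtain ⟨y, hy, g, hg⟩ := hYA fun q => h q
  have hy' : ∃ h ∈ A.solutions (F y), ∀ q : Q, h q = y q := by
    refine ⟨_, automorphism_comp_mem_solutions (solutions_anti ?_ hh) g.symm, fun q => ?_⟩
    · exact Set.subset_biUnion_of_mem (u := F) hy
    · rw [← hg q, FirstOrder.Language.Equiv.symm_apply_apply]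
  obtain ⟨f, hf, hfy⟩ := hFy y hy' G hG hGf
  refine ⟨_, automorphism_comp_mem_solutions hf g, fun q hq => ?_⟩
  rw [hfy ⟨q, hq⟩, hg]

theorem IsFinitelySolvable.extend (hA : A.OmegaCategorical) {Q Q' : Set P} {h : P → A}
    (hh : A.IsFinitelySolvable Φ Q h) (hQ' : Q'.Finite) :
    ∃ h', Set.EqOn h' h Q ∧ A.IsFinitelySolvable Φ Q' h' := by
  obtain ⟨F, hFΦ, hF, h'⟩ := hA.exists_finite_subset_isFinitelySolvable Φ hQ'
  obtain ⟨f, hf, hfh⟩ := hh F hFΦ hF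
  exact ⟨f, hfh, h' f hf⟩

/-- Enumerate `P` and extend stage by stage, keeping finite solvability on the finite sets `D n`;
the limit is a solution. -/
theorem IsFinitelySolvable.exists_solution [Countable P] (hA : A.OmegaCategorical) {Q : Set P}
    (hQ : Q.Finite) {h : P → A} (hh : A.IsFinitelySolvable Φ Q h) :
    ∃ f ∈ A.solutions Φ, Set.EqOn f h Q := by
  obtain ⟨ν, hν⟩ := Countable.exists_injective_nat P
  let D (n : ℕ) : Set P := Q ∪ {p | ν p < n}
  have hD (n : ℕ) : (D n).Finite := hQ.union ((Set.finite_lt_nat n).preimage hν.injOn)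
  have hD_mono : Monotone D := fun a b hab =>
    Set.union_subset_union_right _ fun p hp => lt_of_lt_of_le hp hab
  have hD_mem (p : P) : p ∈ D (ν p + 1) := .inr (Nat.lt_succ_self _)
  obtain ⟨h₀, hh₀, hs₀⟩ := hh.extend hA (hD 0)
  let s (n : ℕ) : {f : P → A // A.IsFinitelySolvable Φ (D n) f} :=
    Nat.rec ⟨h₀, hs₀⟩
      (fun n f => ⟨(f.2.extend hA (hD (n + 1))).choose,
        (f.2.extend hA (hD (n + 1))).choose_spec.2⟩) n
  have hs_succ (n : ℕ) : Set.EqOn (s (n + 1)).1 (s n).1 (D n) :=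
    ((s n).2.extend hA (hD (n + 1))).choose_spec.1
  have hs {n m : ℕ} (hnm : n ≤ m) : Set.EqOn (s m).1 (s n).1 (D n) := by
    induction m, hnm using Nat.le_induction with
    | base => exact fun _ _ => rfl
    | succ m hnm ih => exact ((hs_succ m).mono (hD_mono hnm)).trans ih
  have hs_lim (n : ℕ) : Set.EqOn (fun p => (s (ν p + 1)).1 p) (s n).1 (D n) := by
    intro p hp
    rcases le_total n (ν p + 1) with hle | hle
    · exact hs hle hp
    · exact (hs hle (hD_mem p)).symm
  refine ⟨fun p => (s (ν p + 1)).1 p, fun c hc => ?_, ?_⟩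
  · obtain ⟨n, hn⟩ := (Set.finite_range fun i => ν (c.2.2 i) + 1).bddAbove
    have hcn (i) : c.2.2 i ∈ D n := hD_mono (hn ⟨i, rfl⟩) (hD_mem _)
    -- The constraint `c` involves only points of `D n`, where the limit equals stage `n` and hence
    -- some solution of `{c}`.
    obtain ⟨f, hf, hfs⟩ := (s n).2 {c} (Set.singleton_subset_iff.2 hc) (Set.finite_singleton c)
    rw [show (fun i => _) = fun i => f (c.2.2 i) from
      funext fun i => (hs_lim n (hcn i)).trans (hfs (hcn i)).symm]
    exact hf c rfl
  · exact ((hs_lim 0).mono Set.subset_union_left).trans hh₀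

/-- Only the finite set `V` of points mentioned by `F` or `c` matters; these become the quantified
variables. -/
theorem ppDefinable_solutions [Nonempty A] {ι : Type} [Finite ι]
    {F : Set (Σ k, A.L.Relations k × (Fin k → P))} (hF : F.Finite) (c : ι → P) :
    A.PPDefinable {x | ∃ h ∈ A.solutions F, ∀ i, x i = h (c i)} := by
  classical
  have hV : (Set.range c ∪ ⋃ r ∈ F, Set.range r.2.2).Finite :=
    (Set.finite_range c).union (hF.biUnion fun r _ => Set.finite_range _)
  generalize hVdef : (Set.range c ∪ ⋃ r ∈ F, Set.range r.2.2) = V at hV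
  have hcV (i : ι) : c i ∈ V := hVdef ▸ .inl ⟨i, rfl⟩
  have hFV (r : F) (i) : r.1.2.2 i ∈ V :=
    hVdef ▸ .inr (Set.mem_biUnion r.2 ⟨i, rfl⟩)
  have := hV.to_subtype
  have := hF.to_subtype
  obtain ⟨N, ⟨e⟩⟩ := Finite.exists_equiv_fin V
  have h₁ := A.ppDefinable_forall fun i : ι =>
    A.ppDefinable_eq (Sum.inl i : ι ⊕ Fin N) (.inr (e ⟨c i, hcV i⟩))
  have h₂ := A.ppDefinable_forall fun r : F =>
    A.ppDefinable_rel r.1.2.1 fun i => (Sum.inr (e ⟨r.1.2.2 i, hFV r i⟩) : ι ⊕ Fin N)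
  convert (h₁.inter h₂).exists using 1
  ext x
  constructor
  · rintro ⟨h, hh, hx⟩
    refine ⟨fun j => h (e.symm j), fun i => ?_, fun r => ?_⟩
    · simpa using hx i
    · simpa using hh r r.2
  · rintro ⟨y, hx, hy⟩
    refine ⟨fun p => if hp : p ∈ V then y (e ⟨p, hp⟩) else Classical.arbitrary A,
      fun r hr => ?_, fun i => ?_⟩
    · simpa [hFV ⟨r, hr⟩] using hy ⟨r, hr⟩
    · simpa [hcV i] using hx i

end

theorem automorphism_comp_mem_pol {A : RelStructure.{u, v, w}} {n : ℕ+} (i : Fin n)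
    (g : A ≃[A.L] A) : (fun x => g (x i)) ∈ A.Pol.ops n :=
  fun _ R t ht => (g.map_rel R (t i)).2 (ht i)

/-- In an at most countable `ω`-categorical structure, the nonempty relations that are invariant
under all polymorphisms are pp-definable. -/
theorem OmegaCategorical.ppDefinable_of_invariant {A : RelStructure.{u, v, w}} [Nonempty A]
    [Countable A] (hA : A.OmegaCategorical) {ι : Type} [Finite ι] {S : Set (ι → A)}
    (hS : S.Nonempty) (hpol : ∀ (n : ℕ+), ∀ f ∈ A.Pol.ops n, ∀ t : Fin n → ι → A,
      (∀ i, t i ∈ S) → (fun j => f fun i => t i j) ∈ S) : A.PPDefinable S := by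
  have hAut (g : A ≃[A.L] A) {x : ι → A} (hx : x ∈ S) : (fun i => g (x i)) ∈ S :=
    hpol 1 _ (automorphism_comp_mem_pol 0 g) (fun _ => x) fun _ => hx
  obtain ⟨Y, hY, hYA⟩ := hA.exists_orbit_representatives ι
  have hYS (x) (hx : x ∈ S) : ∃ y ∈ Y ∩ S, ∃ g : A ≃[A.L] A, ∀ i, g (y i) = x i := by
    obtain ⟨y, hy, g, hg⟩ := hYA x
    refine ⟨y, ⟨hy, ?_⟩, g, hg⟩
    convert hAut g.symm hx using 2 with i
    rw [← hg i, FirstOrder.Language.Equiv.symm_apply_apply]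
  have := (hY.inter_of_left S).to_subtype
  obtain ⟨n, ⟨e⟩⟩ := Finite.exists_equiv_fin ↥(Y ∩ S)
  have hn : 0 < n := by
    obtain ⟨x, hx⟩ := hS
    obtain ⟨y, hy, -⟩ := hYS x hx
    exact (Nat.zero_le _).trans_lt (e ⟨y, hy⟩).2
  lift n to ℕ+ using hn
  -- The rows `t j` represent the orbits in `S`. An `n`-ary polymorphism is exactly a solution of
  -- `Φ`, and applying it to the columns `c i` applies it to the rows.
  let t (j : Fin n) : ι → A := (e.symm j).1
  let Φ : Set (Σ k, A.L.Relations k × (Fin k → Fin n → A)) :=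
    {c | ∀ j, RelMap c.2.1 fun i => c.2.2 i j}
  have hΦ (h : (Fin n → A) → A) : h ∈ A.solutions Φ ↔ h ∈ A.Pol.ops n :=
    ⟨fun hh k R r hr => hh ⟨k, R, fun i j => r j i⟩ hr,
      fun hh c hc => hh _ c.2.1 (fun j i => c.2.2 i j) hc⟩
  let c (i : ι) : Fin n → A := fun j => t j i
  obtain ⟨F, hFΦ, hF, hsol⟩ :=
    hA.exists_finite_subset_isFinitelySolvable Φ (Set.finite_range c)
  convert ppDefinable_solutions hF c using 1
  ext x
  constructor
  · intro hx
    obtain ⟨y, hy, g, hg⟩ := hYS x hx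
    -- Every member of `S` is obtained from the rows by a projection followed by an automorphism.
    refine ⟨fun p => g (p (e ⟨y, hy⟩)),
      solutions_anti hFΦ ((hΦ _).2 (automorphism_comp_mem_pol _ g)), fun i => ?_⟩
    simp [c, t, hg]
  · rintro ⟨h, hh, hx⟩
    -- A solution of `F` need not be a polymorphism, but some polymorphism agrees with it on the
    -- columns.
    obtain ⟨f, hf, hfh⟩ := (hsol h hh).exists_solution hA (Set.finite_range c)
    rw [show x = fun i => f (c i) from funext fun i => (hx i).trans (hfh ⟨i, rfl⟩).symm]
    exact hpol n f ((hΦ f).1 hf) t fun j => (e.symm j).2.2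

/-! ### Adding constants to model-complete cores -/

/-- The value of `f` at points `g i s` is the value at `s` of the endomorphism `x ↦ f (g i x)`,
which agrees at `s` with an automorphism. So the orbit is invariant under polymorphisms. -/
theorem OmegaCategorical.ppDefinable_orbit {C : RelStructure.{u, v, w}} [Countable C]
    (hC : C.OmegaCategorical) (hcore : C.IsModelCompleteCore) (s : C) :
    C.PPDefinable {x : Fin 1 → C | ∃ g : C ≃[C.L] C, g s = x 0} := by
  have : Nonempty C := ⟨s⟩
  refine hC.ppDefinable_of_invariant ⟨fun _ => s, .refl C.L C, rfl⟩ fun n f hf t ht => ?_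
  choose g hg using ht
  let e : C →[C.L] C :=
    ⟨fun x => f fun i => g i x, fun f => isEmptyElim f,
      fun R x hx => hf _ R (fun i j => g i (x j)) fun i => ((g i).map_rel R x).2 hx⟩
  obtain ⟨h, hh⟩ := hcore e {s} (Set.finite_singleton s)
  refine ⟨h, (hh s rfl).trans ?_⟩
  exact congrArg f (funext hg)

/-- The second coordinate of a pair stands in for the constant. A pair `(x, y)` represents `g x`,
where the automorphism `g` moves `y` to `s` if `y` is in the orbit of `s`. Old relations demand
equal second coordinates, so that one `g` serves the whole tuple. -/
theorem addSingleton_homEquivPPPower (C : RelStructure.{u, v, w}) [Countable C]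
    (hC : C.OmegaCategorical) (hcore : C.IsModelCompleteCore) (s : C) :
    (C.addSingleton s).HomEquivPPPower C := by
  have : Nonempty C := ⟨s⟩
  have hO := hC.ppDefinable_orbit hcore s
  -- An automorphism is needed off the orbit too, since old relations do not confine the second
  -- coordinate to it.
  have hg (y : C) : ∃ g : C ≃[C.L] C, (∃ h : C ≃[C.L] C, h s = y) → g y = s := by
    by_cases h : ∃ h : C ≃[C.L] C, h s = y
    · obtain ⟨h, rfl⟩ := h
      exact ⟨h.symm, fun _ => h.symm_apply_apply s⟩
    · exact ⟨.refl C.L C, fun h' => absurd h' h⟩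
  choose g hg using hg
  let P (k : ℕ) (R : (C.addSingleton s).L.Relations k) : Set (Fin k × Fin 2 → C) :=
    match R with
    | .inl R => {x | RelMap R fun i => x (i, 0)} ∩ {x | ∀ p : Fin k × Fin k, x (p.1, 1) = x (p.2, 1)}
    | .inr .mk => {x | x (0, 0) = x (0, 1)} ∩ {x | ∃ g : C ≃[C.L] C, g s = x (0, 1)}
  refine .of_maps P (fun b => ![b, s]) (fun x => g (x 1) (x 0)) ?_ ?_ ?_
  · rintro k (R | ⟨⟨⟩⟩)
    · exact (C.ppDefinable_rel R _).inter (C.ppDefinable_forall fun p => C.ppDefinable_eq _ _)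
    · exact (C.ppDefinable_eq _ _).inter (hO.preimage fun _ => (0, 1))
  · rintro k (R | ⟨⟨⟩⟩) t ht
    · exact ⟨ht, fun _ => rfl⟩
    · exact ⟨ht, .refl C.L C, rfl⟩
  · rintro k (R | ⟨⟨⟩⟩) x hx
    · obtain ⟨hR, hx⟩ := hx
      change RelMap R fun i => g (x (i, 1)) (x (i, 0))
      cases k with
      | zero => rwa [Subsingleton.elim (fun i => g (x (i, 1)) (x (i, 0))) fun i => x (i, 0)]
      | succ k =>
        rw [show (fun i => g (x (i, 1)) (x (i, 0))) = fun i => g (x (0, 1)) (x (i, 0)) from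
          funext fun i => congrArg (fun y => g y (x (i, 0))) (hx (i, 0))]
        exact ((g (x (0, 1))).map_rel R _).2 hR
    · obtain ⟨hx, h⟩ := hx
      change g (x (0, 1)) (x (0, 0)) = s
      rw [show x (0, 0) = x (0, 1) from hx, hg _ h]

theorem PPStep.homEquivPPPower {C D : RelStructure.{u, v, w}} [Nonempty D] (h : PPStep C D) :
    D.HomEquivPPPower C := by
  cases h with
  | interpretation h => exact h.homEquivPPPower
  | homEquiv h => exact .of_homEquiv h
  | singleton s _ hC hcore => exact C.addSingleton_homEquivPPPower hC hcore s

theorem PPConstructs.homEquivPPPower {A B : RelStructure.{u, v, w}} [Nonempty B]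
    (h : A.PPConstructs B) : B.HomEquivPPPower A := by
  induction h using Relation.ReflTransGen.head_induction_on with
  | refl => exact .refl B
  | head h _ ih =>
    -- Nonemptiness is known at the end of the chain and is carried backwards.
    have := ih.nonempty
    have := h.homEquivPPPower.nonempty
    exact ih.trans h.homEquivPPPower

/-! ### Polymorphism clones -/

theorem HomEquivPPPower.pol_mem_expansions {A B : RelStructure.{u, v, w}}
    (h : B.HomEquivPPPower A) : B.Pol.toFunctionSet ∈ FunctionSet.expansions
      (FunctionSet.reflections (FunctionSet.finitePowers {A.Pol.toFunctionSet})) := by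
  obtain ⟨n, -, P, h₁, h₂, hP, hh₁, hh₂⟩ := h.exists_maps
  refine ⟨⟨B, fun l => {g | ∃ f ∈ (A.Pol.power n).ops l, g = fun x => h₂ (f fun i => h₁ (x i))}⟩,
    ⟨A.Pol.power n, ⟨_, rfl, n, .refl _, fun l => ?_⟩, h₁, h₂, fun l => rfl⟩, .refl _, ?_⟩
  · ext f
    exact ⟨fun hf => ⟨f, hf, rfl⟩, fun ⟨_, hf, h⟩ => h ▸ hf⟩
  · rintro l _ ⟨_, ⟨f, hf, rfl⟩, rfl⟩ k R t ht
    exact hh₂ k R _ ((hP k R).pol_mem hf fun i => hh₁ k R _ (ht i))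

end RelStructure

/-- Reflection and powers commute with permuting or identifying variables, so height 1 identities
survive definitionally. Since the power is finite, values on `T` depend on finitely many elements:
the coordinates of the images of `T`. -/
theorem FunctionClone.exists_h1Hom_of_mem_expansions {C D : FunctionClone.{u}}
    (h : D.toFunctionSet ∈ FunctionSet.expansions
      (FunctionSet.reflections (FunctionSet.finitePowers {C.toFunctionSet}))) :
    ∃ ξ : ArityMap C D, IsH1Hom ξ ∧ IsUniformlyContinuous ξ := by
  obtain ⟨G, ⟨H, ⟨_, rfl, m, e, he⟩, h₁, h₂, hG⟩, e', hD⟩ := h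
  refine ⟨fun n f => ⟨fun x => e' (h₂ (e fun j => f.1 fun i => e.symm (h₁ (e'.symm (x i))) j)), ?_⟩,
    fun n m σ f => rfl, fun T hT => ?_⟩
  · refine hD n (fun x => h₂ (e fun j => f.1 fun i => e.symm (h₁ (x i)) j)) ?_
    rw [hG]
    refine ⟨fun x => e fun j => f.1 fun i => e.symm (x i) j, ?_, rfl⟩
    rw [he]
    exact ⟨_, ⟨f.1, f.2, rfl⟩, rfl⟩
  · refine ⟨⋃ b ∈ T, Set.range (e.symm (h₁ (e'.symm b))), hT.biUnion fun b _ => Set.finite_range _,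
      fun n f g hfg x hx => ?_⟩
    refine congrArg (fun y => e' (h₂ (e y))) (funext fun j => hfg _ fun i => ?_)
    exact Set.mem_biUnion (hx i) ⟨j, rfl⟩

namespace RelStructure

open Classical in
theorem OmegaCategorical.homEquivPPPower_of_h1Hom {A B : RelStructure.{u, v, w}} [Nonempty A]
    [Nonempty B] [Countable A] (hA : A.OmegaCategorical) [Finite B]
    (hB : (∀ (k : ℕ) (R : B.L.Relations k), ∃ x : Fin k → B, RelMap R x) ∨
      A.PPDefinable (∅ : Set (Fin 1 → A)))
    {ξ : FunctionClone.ArityMap A.Pol B.Pol} (hξ : FunctionClone.IsH1Hom ξ)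
    (hξc : FunctionClone.IsUniformlyContinuous ξ) : B.HomEquivPPPower A := by
  obtain ⟨S, hS, hξS⟩ := hξc Set.univ (Set.toFinite (α := B) _)
  obtain ⟨n, ⟨e⟩⟩ := Finite.exists_equiv_fin B
  lift n to ℕ+ using Fin.pos (e (Classical.arbitrary B))
  -- The extra point makes the index set of the power nonempty.
  have hS' : (insert (Classical.arbitrary A) S).Finite := hS.insert _
  have := hS'.to_subtype
  obtain ⟨M, ⟨σ⟩⟩ := Finite.exists_equiv_fin ↥(insert (Classical.arbitrary A) S)
  have : Nonempty (Fin M) := ⟨σ ⟨_, Set.mem_insert _ _⟩⟩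
  -- `h₁ b` is the restricted projection to the coordinate numbered by `b`.
  let h₁ (b : B) (i : Fin n → Fin M) : A := (σ.symm (i (e b))).1
  let restr (f : A.Pol.ops n) (i : Fin n → Fin M) : A := f.1 fun j => (σ.symm (i j)).1
  let h₂ (x : (Fin n → Fin M) → A) : B :=
    if h : ∃ f, restr f = x then (ξ n h.choose).1 e.symm else Classical.arbitrary B
  have hh₂ (f : A.Pol.ops n) : h₂ (restr f) = (ξ n f).1 e.symm := by
    have h : ∃ g, restr g = restr f := ⟨f, rfl⟩
    -- The choice made in `h₂` is harmless: polymorphisms with equal restrictions have the same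
    -- image under `ξ`.
    refine (dif_pos h).trans (hξS n _ _ (fun x hx => ?_) _ fun i => trivial)
    have := congrFun h.choose_spec fun j => σ ⟨x j, .inr (hx j)⟩
    simp only [restr, Equiv.symm_apply_apply] at this
    exact this
  have key (k : ℕ) (R : B.L.Relations k) : ∃ P : Set (Fin k × (Fin n → Fin M) → A),
      A.PPDefinable P ∧ (∀ t, RelMap R t → (fun p => h₁ (t p.1) p.2) ∈ P) ∧
      ∀ x ∈ P, RelMap R fun i => h₂ fun j => x (i, j) := by
    by_cases hR : ∃ x : Fin k → B, RelMap R x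
    · obtain ⟨m, ⟨r⟩⟩ := Finite.exists_equiv_fin {x : Fin k → B // RelMap R x}
      lift m to ℕ+ using Fin.pos (r ⟨_, hR.choose_spec⟩)
      have hproj (t) (ht : RelMap R t) : ∃ f ∈ A.Pol.ops m, (fun p => h₁ (t p.1) p.2) =
          fun p : Fin k × (Fin n → Fin M) => f fun i => h₁ ((r.symm i).1 p.1) p.2 :=
        ⟨_, A.Pol.proj_mem m (r ⟨t, ht⟩), by simp⟩
      refine ⟨{x | ∃ f ∈ A.Pol.ops m, x = fun p => f fun i => h₁ ((r.symm i).1 p.1) p.2},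
        hA.ppDefinable_of_invariant ⟨_, hproj _ hR.choose_spec⟩ fun l f hf t ht => ?_, hproj, ?_⟩
      · choose g hg ht using ht
        exact ⟨_, A.Pol.comp_mem hf hg, by simp only [ht]; rfl⟩
      · rintro _ ⟨f, hf, rfl⟩
        have h (a : Fin k) : (h₂ fun j => f fun i => h₁ ((r.symm i).1 a) j) =
            (ξ m ⟨f, hf⟩).1 fun i => (r.symm i).1 a := by
          -- Row `a` is the restriction of a minor of `f`. As `ξ` commutes with minors, `h₂` sends
          -- it to `ξ f` applied to the `a`-th entries of the tuples of `R`.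
          refine (hh₂ (A.Pol.comp ⟨f, hf⟩ fun i => A.Pol.proj n (e ((r.symm i).1 a)))).trans ?_
          rw [hξ]
          simp only [FunctionClone.comp, FunctionClone.proj, Equiv.symm_apply_apply]
          rfl
        simp only [h]
        exact (ξ m ⟨f, hf⟩).2 k R _ fun i => (r.symm i).2
    · have hE := hB.resolve_left fun h => hR (h k R)
      refine ⟨∅, ?_, fun t ht => absurd ⟨t, ht⟩ hR, fun x hx => absurd hx (Set.notMem_empty x)⟩
      -- A dummy quantified variable carries the contradiction, which also covers `k = 0`.
      convert (hE.preimage (Sum.inr : Fin 1 → Fin k × (Fin n → Fin M) ⊕ Fin 1)).exists using 1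
      simp
  choose P hP hP₁ hP₂ using key
  exact .of_maps P h₁ h₂ hP hP₁ hP₂

end RelStructure

theorem theorem1p5 (A B : RelStructure.{u, v, w}) [Nonempty A] [Nonempty B]
    [Countable A] (hA : A.OmegaCategorical) [Finite B]
    (hB : (∀ (k : ℕ) (R : B.L.Relations k), ∃ x : Fin k → B, RelMap R x) ∨
      A.PPDefinable (∅ : Set (Fin 1 → A))) :
    List.TFAE [
      ∃ C : RelStructure.{u, v, w}, C.IsPPPower A ∧ B.HomEquiv C,
      A.PPConstructs B,
      B.Pol.toFunctionSet ∈ FunctionSet.expansions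
        (FunctionSet.reflections (FunctionSet.finitePowers {A.Pol.toFunctionSet})),
      ∃ ξ : FunctionClone.ArityMap A.Pol B.Pol,
        FunctionClone.IsH1Hom ξ ∧ FunctionClone.IsUniformlyContinuous ξ] := by
  tfae_have 1 → 2 := RelStructure.HomEquivPPPower.ppConstructs
  tfae_have 2 → 1 := RelStructure.PPConstructs.homEquivPPPower
  tfae_have 1 → 3 := RelStructure.HomEquivPPPower.pol_mem_expansions
  tfae_have 3 → 4 := FunctionClone.exists_h1Hom_of_mem_expansions
  tfae_have 4 → 1 := fun ⟨_, hξ, hξc⟩ => hA.homEquivPPPower_of_h1Hom hB hξ hξc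
  tfae_finish
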